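/- Let $[n]=\{1,\dots,n\}$ be the set of alternatives. A set $\mathcal D$ of linear orders on $[n]$ is a \emph{Condorcet domain} if, for every profile with an odd number of agents whose preferences all belong to $\mathcal D$, the majority relation is transitive. For $i,j\in\{1,2,3\}$, a linear order satisfies the never condition $iNj$ on a triple $a<b<c$ if the $i$-th element of the triple (in the order $a<b<c$) is not ranked $j$-th when the order is restricted to $\{a,b,c\}$. A Condorcet domain is \emph{peak-pit} if it is the set of all linear orders satisfying some assignment of one never condition to each triple, in which every assigned condition is of the form $iN1$ or $iN3$. Let $f(n)$ and $h(n)$ be the maximum sizes of a Condorcet domain and of a peak-pit Condorcet domain on $n$ alternatives, respectively. The \emph{Fishburn domain} on $n$ alternatives is the set of linear orders satisfying $2N1$ on every triple whose middle element is even and $2N3$ on every other triple. (a) For $n=9,10,\dots,20$ there is a peak-pit Condorcet domain on $n$ alternatives of size exactly $s_n$, where $(s_9,\dots,s_{20})=(492,\ 1104,\ 2452,\ 5520,\ 12182,\ 27026,\ 59430,\ 131536,\ 292015,\ 649079,\ 1432836,\ 3155366)$; in particular $h(n)\ge s_n$ and $f(n)\ge s_n$. (b) For $n=21,\dots,25$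 there is a Condorcet domain on $n$ alternatives of size exactly $s_n$, where $(s_{21},\dots,s_{25})=(6674931,\ 15037178,\ 33162136,\ 73279872,\ 160316046)$; moreover $h(n)\ge s_n$ and $f(n)\ge s_n$. (c) For every $9\le n\le 25$, $s_n$ is strictly larger than the size of the Fishburn domain on $n$ alternatives. For $9\le n\le 20$, both $h(n)$ and $f(n)$ are strictly larger than the best previously known lower bound $r_n$, where $(r_9,\dots,r_{20})=(488,\ 1082,\ 2349,\ 5034,\ 10940,\ 24481,\ 54752,\ 123004,\ 271758,\ 602299,\ 1323862,\ 2917604)$. -/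

import Mathlib

/-- A linear order (preference order) on the alternatives `Fin n`, encoded as the permutation that
sends each alternative to its position, with position `0` the most preferred one. The alternative
written `i + 1` in `[n] = {1, …, n}` is `i : Fin n`. -/
abbrev PrefOrder (n : ℕ) : Type := Equiv.Perm (Fin n)

namespace PrefOrder

/-- `P.Prefers a b`: the alternative `a` is ranked above `b`. -/
def Prefers {n : ℕ} (P : PrefOrder n) (a b : Fin n) : Prop := P a < P b

instance {n : ℕ} (P : PrefOrder n) (a b : Fin n) : Decidable (P.Prefers a b) :=
  inferInstanceAs (Decidable (P a < P b))

end PrefOrder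

/-- The (strict) majority relation of a profile of `m` agents. -/
def MajorityPrefers {n m : ℕ} (profile : Fin m → PrefOrder n) (a b : Fin n) : Prop :=
  (Finset.univ.filter fun i => (profile i).Prefers b a).card <
    (Finset.univ.filter fun i => (profile i).Prefers a b).card

/-- A domain is a Condorcet domain if the majority relation of every profile with an odd number of
agents, all of whose preferences belong to the domain, is transitive. -/
def IsCondorcetDomain {n : ℕ} (D : Finset (PrefOrder n)) : Prop :=
  ∀ (m : ℕ), Odd m → ∀ profile : Fin m → PrefOrder n, (∀ i, profile i ∈ D) →
    ∀ a b c : Fin n, MajorityPrefers profile a b → MajorityPrefers profile b c →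
      MajorityPrefers profile a c

/-- A triple of alternatives, listed increasingly (that is, along the societal axis). -/
abbrev Triple (n : ℕ) : Type := Fin 3 ↪o Fin n

/-- The never condition `iNj`, `i, j ∈ {1, 2, 3}`; both indices are stored 0-based, so that
`⟨0, 2⟩` is `1N3`. -/
structure NeverCondition where
  /-- Which alternative of the triple, in the order of the societal axis. -/
  alt : Fin 3
  /-- Which position within the triple it never occupies. -/
  pos : Fin 3

/-- The position (`0`, `1` or `2`) of the `i`-th alternative of the triple `t` in the restriction
of `P` to `t`: the number of alternatives of `t` that are ranked above it. -/
def positionInTriple {n : ℕ} (P : PrefOrder n) (t : Triple n) (i : Fin 3) : ℕ :=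
  (Finset.univ.filter fun k : Fin 3 => P.Prefers (t k) (t i)).card

/-- `P` satisfies the never condition `c` on the triple `t`. -/
def Satisfies {n : ℕ} (P : PrefOrder n) (t : Triple n) (c : NeverCondition) : Prop :=
  positionInTriple P t c.alt ≠ (c.pos : ℕ)

open Classical in
/-- The domain of all linear orders that satisfy a complete set `N` of never conditions
(one for each triple). -/
noncomputable def domainOf {n : ℕ} (N : Triple n → NeverCondition) : Finset (PrefOrder n) :=
  Finset.univ.filter fun P => ∀ t : Triple n, Satisfies P t (N t)

/-- A Condorcet domain is a peak-pit domain if it is defined by a complete set of never conditions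
all of which are of type `iN1` or `iN3`. -/
def IsPeakPitDomain {n : ℕ} (D : Finset (PrefOrder n)) : Prop :=
  IsCondorcetDomain D ∧
    ∃ N : Triple n → NeverCondition, (∀ t, (N t).pos = 0 ∨ (N t).pos = 2) ∧ D = domainOf N

/-- The maximum size of a Condorcet domain on `n` alternatives. The set is non-empty and bounded
by `n!`. -/
noncomputable def maxCondorcetSize (n : ℕ) : ℕ :=
  sSup {k | ∃ D : Finset (PrefOrder n), IsCondorcetDomain D ∧ D.card = k}

/-- The maximum size of a peak-pit Condorcet domain on `n` alternatives. The set is non-empty and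
bounded by `n!`. -/
noncomputable def maxPeakPitSize (n : ℕ) : ℕ :=
  sSup {k | ∃ D : Finset (PrefOrder n), IsPeakPitDomain D ∧ D.card = k}

/-- Fishburn's alternating scheme: `2N1` if the middle element of the triple, as an element of
`{1, …, n}`, is even, and `2N3` otherwise. -/
def alternatingScheme (n : ℕ) (t : Triple n) : NeverCondition :=
  if Even ((t 1 : ℕ) + 1) then ⟨1, 0⟩ else ⟨1, 2⟩

/-- The Fishburn domain on `n` alternatives. -/
noncomputable def fishburnDomain (n : ℕ) : Finset (PrefOrder n) :=
  domainOf (alternatingScheme n)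

/-! Every scheme of conditions `iN1`/`iN3` defines a peak-pit Condorcet domain, so each lower bound
reduces to exhibiting a scheme and counting its orders. Condorcet property: if some alternative of
each triple is never first, or never last, then no majority cycle on that triple is possible
(`isCondorcetDomain_of_neverExtreme`). The argument needs `MajorityPrefers profile a b` to compare
the tally of `b` over `a` with that of `a` over `b`. As written, both sides of that definition count
`b` over `a`, so the relation is empty, every domain is vacuously Condorcet, and
`majorityPrefers_or` fails for `a ≠ b` and odd `m`. Counting: an order is a maximal chain of initial
segments, and a condition `iN1` or `iN3` forbids certain sets as initial segments. The domain is
thus the set of maximal chains through admissible sets, and since the number of continuations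
depends only on the current set, these chains can be counted level by level over subsets rather than
over orders (`card_domainOf`, `card_agreeing`). Computation: sets are coded as bit masks, and
admissibility of a set becomes two bitwise conjunctions of large numbers (`passes_iff`). The
recursion is arranged for kernel evaluation and proved correct in `card_domainOf_scheme`; explicit
tables then give the sizes. For 21 to 25 alternatives the exhibited peak-pit domains exceed the
required sizes, and the exact sizes come from subsets. -/

namespace PeakPit

/-! ### Never conditions and the Condorcet property -/

/-- An implication between individual preferences gives an inequality of tallies, and its
contrapositive gives the inequality of the reversed tallies. Together these are incompatible with
strict majorities around the cycle. -/
theorem majority_not_cyclic {n m : ℕ} (f : Fin m → PrefOrder n) {x y z : Fin n}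
    (h : (∀ i, (f i).Prefers x y → (f i).Prefers z y) ∨
      (∀ i, (f i).Prefers z x → (f i).Prefers z y))
    (hxy : MajorityPrefers f x y) (hyz : MajorityPrefers f y z) (hzx : MajorityPrefers f z x) :
    False := by
  unfold MajorityPrefers at *
  have key : ∀ a b c d : Fin n, (∀ i, (f i).Prefers a b → (f i).Prefers c d) →
      (Finset.univ.filter fun i => (f i).Prefers a b).card ≤
        (Finset.univ.filter fun i => (f i).Prefers c d).card := fun a b c d H =>
    Finset.card_le_card fun i hi => by
      simp only [Finset.mem_filter, Finset.mem_univ, true_and] at hi ⊢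
      exact H i hi
  have anti : ∀ a b c d : Fin n, (∀ i, (f i).Prefers a b → (f i).Prefers c d) → a ≠ b → c ≠ d →
      (Finset.univ.filter fun i => (f i).Prefers d c).card ≤
        (Finset.univ.filter fun i => (f i).Prefers b a).card := fun a b c d H hab hcd =>
    key d c b a fun i hi => by
      by_contra hba
      have hne : f i a ≠ f i b := fun e => hab ((f i).injective e)
      have := H i (lt_of_le_of_ne (not_lt.mp hba) hne)
      exact lt_asymm hi this
  have hxy' : x ≠ y := by rintro rfl; exact lt_irrefl _ hxy
  have hyz' : z ≠ y := by rintro rfl; exact lt_irrefl _ hyz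
  have hzx' : z ≠ x := by rintro rfl; exact lt_irrefl _ hzx
  rcases h with h | h
  · have h1 := key x y z y h
    have h2 := anti x y z y h hxy' hyz'
    omega
  · have h1 := key z x z y h
    have h2 := anti z x z y h hzx' hyz'
    omega

/-- The alternative `x` is never first, or never last, among `x`, `y`, `z`. -/
def NeverExtreme {n : ℕ} (D : Finset (PrefOrder n)) (x y z : Fin n) : Prop :=
  (∀ P ∈ D, ¬ (P.Prefers x y ∧ P.Prefers x z)) ∨ (∀ P ∈ D, ¬ (P.Prefers y x ∧ P.Prefers z x))

theorem NeverExtreme.symm {n : ℕ} {D : Finset (PrefOrder n)} {x y z : Fin n}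
    (h : NeverExtreme D x y z) : NeverExtreme D x z y := by
  unfold NeverExtreme at *
  simpa only [and_comm] using h

theorem prefers_of_not {n : ℕ} {P : PrefOrder n} {a b : Fin n} (hab : a ≠ b)
    (h : ¬ P.Prefers a b) : P.Prefers b a :=
  lt_of_le_of_ne (not_lt.mp h) fun e => hab (P.injective e).symm

theorem NeverExtreme.not_cyclic {n m : ℕ} {D : Finset (PrefOrder n)} {x y z : Fin n}
    (h : NeverExtreme D x y z) (f : Fin m → PrefOrder n) (hf : ∀ i, f i ∈ D)
    (hxy : MajorityPrefers f x y) (hyz : MajorityPrefers f y z) (hzx : MajorityPrefers f z x) :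
    False := by
  have hzx' : x ≠ z := by rintro rfl; exact lt_irrefl _ hzx
  have hxy' : y ≠ x := by rintro rfl; exact lt_irrefl _ hxy
  refine majority_not_cyclic f ?_ hxy hyz hzx
  rcases h with h | h
  · left
    intro i hi
    have : (f i).Prefers z x := prefers_of_not hzx' fun hx => h _ (hf i) ⟨hi, hx⟩
    exact lt_trans this hi
  · right
    intro i hi
    have : (f i).Prefers x y := prefers_of_not hxy' fun hx => h _ (hf i) ⟨hx, hi⟩
    exact lt_trans hi this

theorem majorityPrefers_or {n m : ℕ} (hm : Odd m) (f : Fin m → PrefOrder n) {a b : Fin n}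
    (hab : a ≠ b) : MajorityPrefers f a b ∨ MajorityPrefers f b a := by
  unfold MajorityPrefers
  have h : (Finset.univ.filter fun i => (f i).Prefers a b).card +
      (Finset.univ.filter fun i => (f i).Prefers b a).card = m := by
    have e : (Finset.univ.filter fun i => (f i).Prefers b a) =
        Finset.univ.filter fun i => ¬ (f i).Prefers a b := by
      ext i
      simp only [Finset.mem_filter, Finset.mem_univ, true_and]
      exact ⟨fun h h' => lt_asymm h h', prefers_of_not hab⟩
    rw [e, Finset.card_filter_add_card_filter_not]
    simp
  obtain ⟨k, hk⟩ := hm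
  omega

/-- A failure of transitivity would close a majority cycle, by totality for odd profiles. A cycle
may be read from any of its vertices, so it does not matter which alternative is never extreme. -/
theorem isCondorcetDomain_of_neverExtreme {n : ℕ} {D : Finset (PrefOrder n)}
    (h : ∀ a b c : Fin n, a ≠ b → b ≠ c → a ≠ c →
      NeverExtreme D a b c ∨ NeverExtreme D b c a ∨ NeverExtreme D c a b) :
    IsCondorcetDomain D := by
  intro m hm f hf a b c hab hbc
  have h1 : a ≠ b := by rintro rfl; exact lt_irrefl _ hab
  have h2 : b ≠ c := by rintro rfl; exact lt_irrefl _ hbc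
  have h3 : a ≠ c := by rintro rfl; exact lt_asymm hab hbc
  refine (majorityPrefers_or hm f h3).resolve_right fun hca => ?_
  rcases h a b c h1 h2 h3 with h | h | h
  · exact h.not_cyclic f hf hab hbc hca
  · exact h.not_cyclic f hf hbc hca hab
  · exact h.not_cyclic f hf hca hab hbc

/-! ### Never conditions as conditions on initial segments -/

/-- The set `s` cannot be an initial segment of an order satisfying the condition `c` on `t`. -/
def Violates {n : ℕ} (s : Finset (Fin n)) (t : Triple n) (c : NeverCondition) : Prop :=
  if c.pos = 0 then ∀ k, t k ∈ s ↔ k = c.alt else ∀ k, t k ∈ s ↔ k ≠ c.alt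

/-- No never condition rules out `s` as an initial segment. -/
def Admissible {n : ℕ} (N : Triple n → NeverCondition) (s : Finset (Fin n)) : Prop :=
  ∀ t, ¬ Violates s t (N t)

/-- The set of the `j` most preferred alternatives of `P`. -/
def initialSegment {n : ℕ} (P : PrefOrder n) (j : ℕ) : Finset (Fin n) :=
  Finset.univ.filter fun a => (P a : ℕ) < j

theorem positionInTriple_eq_zero {n : ℕ} (P : PrefOrder n) (t : Triple n) (i : Fin 3) :
    positionInTriple P t i = 0 ↔ ∀ k, k ≠ i → P.Prefers (t i) (t k) := by
  rw [positionInTriple, Finset.card_eq_zero, Finset.filter_eq_empty_iff]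
  constructor
  · intro h k hk
    exact prefers_of_not (fun e => hk (t.injective e)) (h (Finset.mem_univ k))
  · intro h k _ hk
    by_cases e : k = i
    · subst e; exact lt_irrefl _ hk
    · exact lt_asymm hk (h k e)

theorem positionInTriple_eq_two {n : ℕ} (P : PrefOrder n) (t : Triple n) (i : Fin 3) :
    positionInTriple P t i = 2 ↔ ∀ k, k ≠ i → P.Prefers (t k) (t i) := by
  have hsub : (Finset.univ.filter fun k : Fin 3 => P.Prefers (t k) (t i)) ⊆
      Finset.univ.erase i := fun k hk => by
    simp only [Finset.mem_filter, Finset.mem_univ, true_and] at hk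
    refine Finset.mem_erase.2 ⟨?_, Finset.mem_univ _⟩
    rintro rfl
    exact lt_irrefl _ hk
  have hc : (Finset.univ.erase i : Finset (Fin 3)).card = 2 := by
    rw [Finset.card_erase_of_mem (Finset.mem_univ i)]; rfl
  constructor
  · intro h k hk
    have e := Finset.eq_of_subset_of_card_le hsub (by rw [hc]; exact h.ge)
    have : k ∈ Finset.univ.erase i := Finset.mem_erase.2 ⟨hk, Finset.mem_univ _⟩
    rw [← e] at this
    exact (Finset.mem_filter.1 this).2
  · intro h
    rw [positionInTriple, ← hc]
    congr 1
    refine Finset.Subset.antisymm hsub fun k hk => ?_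
    exact Finset.mem_filter.2 ⟨Finset.mem_univ _, h k (Finset.ne_of_mem_erase hk)⟩

/-- An alternative is first in the triple iff some initial segment meets the triple in it alone, and
last iff some initial segment contains exactly the other two. Middle positions have no such
description, hence `hc`. -/
theorem satisfies_iff {n : ℕ} (P : PrefOrder n) (t : Triple n) {c : NeverCondition}
    (hc : c.pos = 0 ∨ c.pos = 2) :
    Satisfies P t c ↔ ∀ j ≤ n, ¬ Violates (initialSegment P j) t c := by
  have mem : ∀ j k, t k ∈ initialSegment P j ↔ (P (t k) : ℕ) < j := fun j k => by
    simp [initialSegment]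
  unfold Satisfies
  rw [← not_iff_not]
  push Not
  rcases hc with h0 | h2
  · rw [h0]
    change positionInTriple P t c.alt = 0 ↔ _
    rw [positionInTriple_eq_zero]
    simp only [Violates, h0, if_true, mem]
    constructor
    · intro h
      -- The segment ending with the named alternative; in the never-last case below it stops just
      -- before it.
      refine ⟨P (t c.alt) + 1, (P (t c.alt)).2, fun k => ⟨fun hk => ?_, fun hk => ?_⟩⟩
      · by_contra hne
        have := h k hne
        simp only [PrefOrder.Prefers, Fin.lt_def] at this
        omega
      · subst hk; omega
    · rintro ⟨j, _, hj⟩ k hk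
      have h1 := (hj c.alt).2 rfl
      have h2 := mt (hj k).1 hk
      simp only [PrefOrder.Prefers, Fin.lt_def]
      omega
  · have hne : c.pos ≠ 0 := by rw [h2]; decide
    rw [h2]
    change positionInTriple P t c.alt = 2 ↔ _
    rw [positionInTriple_eq_two]
    simp only [Violates, hne, if_false, mem]
    constructor
    · intro h
      refine ⟨P (t c.alt), (P (t c.alt)).2.le, fun k => ⟨fun hk e => ?_, fun hk => ?_⟩⟩
      · subst e; omega
      · have := h k hk
        simpa only [PrefOrder.Prefers, Fin.lt_def] using this
    · rintro ⟨j, _, hj⟩ k hk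
      have h1 := (hj k).2 hk
      have h2 := mt (hj c.alt).1 (not_not.2 rfl)
      simp only [PrefOrder.Prefers, Fin.lt_def]
      omega

theorem mem_domainOf_iff {n : ℕ} {N : Triple n → NeverCondition}
    (hN : ∀ t, (N t).pos = 0 ∨ (N t).pos = 2) (P : PrefOrder n) :
    P ∈ domainOf N ↔ ∀ j ≤ n, Admissible N (initialSegment P j) := by
  simp only [domainOf, Finset.mem_filter, Finset.mem_univ, true_and]
  constructor
  · exact fun h j hj t => (satisfies_iff P t (hN t)).1 (h t) j hj
  · exact fun h t => (satisfies_iff P t (hN t)).2 fun j hj => h j hj t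

theorem exists_triple {n : ℕ} {a b c : Fin n} (hab : a < b) (hbc : b < c) :
    ∃ t : Triple n, t 0 = a ∧ t 1 = b ∧ t 2 = c := by
  refine ⟨OrderEmbedding.ofStrictMono ![a, b, c] ?_, rfl, rfl, rfl⟩
  rw [Fin.strictMono_iff_lt_succ]
  intro i
  fin_cases i
  · exact hab
  · exact hbc

theorem neverExtreme_domainOf {n : ℕ} {N : Triple n → NeverCondition}
    (hN : ∀ t, (N t).pos = 0 ∨ (N t).pos = 2) {a b c : Fin n} (hab : a < b) (hbc : b < c) :
    NeverExtreme (domainOf N) a b c ∨ NeverExtreme (domainOf N) b c a ∨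
      NeverExtreme (domainOf N) c a b := by
  obtain ⟨t, rfl, rfl, rfl⟩ := exists_triple hab hbc
  have key : ∀ i j k : Fin 3, (∀ l, l ≠ i → l = j ∨ l = k) → (N t).alt = i →
      NeverExtreme (domainOf N) (t i) (t j) (t k) := by
    rintro i j k hl rfl
    have sat : ∀ P ∈ domainOf N, Satisfies P t (N t) := fun P hP => by
      simp only [domainOf, Finset.mem_filter, Finset.mem_univ, true_and] at hP
      exact hP t
    rcases hN t with h | h
    · left
      rintro P hP ⟨h1, h2⟩
      refine sat P hP ?_
      rw [h]
      refine (positionInTriple_eq_zero P t _).2 fun l hne => ?_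
      rcases hl l hne with rfl | rfl <;> assumption
    · right
      rintro P hP ⟨h1, h2⟩
      refine sat P hP ?_
      rw [h]
      refine (positionInTriple_eq_two P t _).2 fun l hne => ?_
      rcases hl l hne with rfl | rfl <;> assumption
  have h3 : ∀ i : Fin 3, i = 0 ∨ i = 1 ∨ i = 2 := by decide
  rcases h3 (N t).alt with h | h | h
  · exact Or.inl (key 0 1 2 (by decide) h)
  · exact Or.inr (Or.inl (key 1 2 0 (by decide) h))
  · exact Or.inr (Or.inr (key 2 0 1 (by decide) h))

theorem isPeakPitDomain_domainOf {n : ℕ} {N : Triple n → NeverCondition}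
    (hN : ∀ t, (N t).pos = 0 ∨ (N t).pos = 2) : IsPeakPitDomain (domainOf N) := by
  refine ⟨isCondorcetDomain_of_neverExtreme fun a b c h1 h2 h3 => ?_, N, hN, rfl⟩
  have key := fun {a b c : Fin n} => neverExtreme_domainOf hN (a := a) (b := b) (c := c)
  -- Of the eight sign patterns two are cyclic and absurd. Even permutations of the sorted triple
  -- only rotate the disjunction; odd ones also use `NeverExtreme.symm`.
  rcases lt_or_gt_of_ne h1 with h1 | h1 <;> rcases lt_or_gt_of_ne h2 with h2 | h2 <;>
    rcases lt_or_gt_of_ne h3 with h3 | h3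
  · exact key h1 h2
  · exact absurd (h1.trans h2) h3.asymm
  · rcases key h3 h2 with h | h | h
    · exact Or.inl h.symm
    · exact Or.inr (Or.inr h.symm)
    · exact Or.inr (Or.inl h.symm)
  · rcases key h3 h1 with h | h | h
    · exact Or.inr (Or.inr h)
    · exact Or.inl h
    · exact Or.inr (Or.inl h)
  · rcases key h1 h3 with h | h | h
    · exact Or.inr (Or.inl h.symm)
    · exact Or.inl h.symm
    · exact Or.inr (Or.inr h.symm)
  · rcases key h2 h3 with h | h | h
    · exact Or.inr (Or.inl h)
    · exact Or.inr (Or.inr h)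
    · exact Or.inl h
  · exact absurd (h2.trans h1) h3.asymm
  · rcases key h2 h1 with h | h | h
    · exact Or.inr (Or.inr h.symm)
    · exact Or.inr (Or.inl h.symm)
    · exact Or.inl h.symm

/-! ### Sizes of Condorcet domains -/

/-- The supremum in ℕ is meaningful only for bounded sets; the number of all orders is the bound. -/
theorem card_le_maxCondorcetSize {n : ℕ} {D : Finset (PrefOrder n)} (h : IsCondorcetDomain D) :
    D.card ≤ maxCondorcetSize n :=
  le_csSup ⟨Fintype.card (PrefOrder n), by rintro k ⟨E, _, rfl⟩; exact E.card_le_univ⟩ ⟨D, h, rfl⟩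

theorem card_le_maxPeakPitSize {n : ℕ} {D : Finset (PrefOrder n)} (h : IsPeakPitDomain D) :
    D.card ≤ maxPeakPitSize n :=
  le_csSup ⟨Fintype.card (PrefOrder n), by rintro k ⟨E, _, rfl⟩; exact E.card_le_univ⟩ ⟨D, h, rfl⟩

theorem isCondorcetDomain_mono {n : ℕ} {D E : Finset (PrefOrder n)} (hDE : D ⊆ E)
    (h : IsCondorcetDomain E) : IsCondorcetDomain D :=
  fun m hm f hf => h m hm f fun i => hDE (hf i)

/-! ### Counting a domain by its chains of initial segments -/

open Classical in
/-- The number of ways to extend `s` by `k` further alternatives, one at a time, through admissible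
sets. -/
noncomputable def completions {n : ℕ} (N : Triple n → NeverCondition) :
    ℕ → Finset (Fin n) → ℕ
  | 0, _ => 1
  | k + 1, s => ∑ x ∈ sᶜ, if Admissible N (insert x s) then completions N k (insert x s) else 0

theorem initialSegment_congr {n : ℕ} {P Q : PrefOrder n} {j : ℕ}
    (h : ∀ i : Fin n, (i : ℕ) < j → P.symm i = Q.symm i) :
    initialSegment P j = initialSegment Q j := by
  ext a
  simp only [initialSegment, Finset.mem_filter, Finset.mem_univ, true_and]
  constructor
  · intro ha
    have := h (P a) ha
    rw [Equiv.symm_apply_apply, Equiv.eq_symm_apply] at this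
    rwa [this]
  · intro ha
    have := h (Q a) ha
    rw [Equiv.symm_apply_apply, Equiv.symm_apply_eq] at this
    rwa [← this]

theorem initialSegment_succ {n : ℕ} (P : PrefOrder n) {j : ℕ} (hj : j < n) :
    initialSegment P (j + 1) = insert (P.symm ⟨j, hj⟩) (initialSegment P j) := by
  ext a
  simp only [initialSegment, Finset.mem_filter, Finset.mem_univ, true_and, Finset.mem_insert,
    Equiv.eq_symm_apply, Fin.ext_iff]
  omega

open Classical in
-- The orders sharing the first `j` places with `Q` are classified by the alternative in the next
-- place. The count depends on `Q` only through the set of its first `j` alternatives.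
theorem card_agreeing {n : ℕ} (N : Triple n → NeverCondition) (k j : ℕ) (hkj : k + j = n)
    (Q : PrefOrder n) :
    (Finset.univ.filter fun P : PrefOrder n =>
      (∀ i : Fin n, (i : ℕ) < j → P.symm i = Q.symm i) ∧
        ∀ l, j < l → l ≤ n → Admissible N (initialSegment P l)).card =
      completions N k (initialSegment Q j) := by
  induction k generalizing j Q with
  | zero =>
    have : (Finset.univ.filter fun P : PrefOrder n =>
        (∀ i : Fin n, (i : ℕ) < j → P.symm i = Q.symm i) ∧
          ∀ l, j < l → l ≤ n → Admissible N (initialSegment P l)) = {Q} := by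
      ext P
      simp only [Finset.mem_filter, Finset.mem_univ, true_and, Finset.mem_singleton]
      constructor
      · rintro ⟨h, -⟩
        have e : P.symm = Q.symm := Equiv.ext fun i => h i (by omega)
        rw [← P.symm_symm, e, Q.symm_symm]
      · rintro rfl
        exact ⟨fun _ _ => rfl, fun l h1 h2 => by omega⟩
    rw [this, Finset.card_singleton, completions]
  | succ k ih =>
    have hj : j < n := by omega
    rw [completions, Finset.card_eq_sum_card_fiberwise (f := fun P : PrefOrder n => P.symm ⟨j, hj⟩)
      (t := (initialSegment Q j)ᶜ)]
    · refine Finset.sum_congr rfl fun x hx => ?_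
      have hxj : j ≤ (Q x : ℕ) := by
        simpa [initialSegment] using hx
      -- A representative of the fibre over `x`: swapping places `j` and `Q x` puts `x` in place `j`
      -- and leaves the earlier places untouched.
      set R : PrefOrder n := Q.trans (Equiv.swap ⟨j, hj⟩ (Q x)) with hR
      have hRs : ∀ i, R.symm i = Q.symm (Equiv.swap ⟨j, hj⟩ (Q x) i) := fun i => rfl
      have hRj : R.symm ⟨j, hj⟩ = x := by rw [hRs]; simp
      have hRi : ∀ i : Fin n, (i : ℕ) < j → R.symm i = Q.symm i := fun i hi => by
        rw [hRs, Equiv.swap_apply_of_ne_of_ne]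
        · rintro rfl; simp at hi
        · rintro rfl; omega
      have hseg : initialSegment R (j + 1) = insert x (initialSegment Q j) := by
        rw [initialSegment_succ R hj, hRj, initialSegment_congr hRi]
      have agree : ∀ P : PrefOrder n, (∀ i : Fin n, (i : ℕ) < j + 1 → P.symm i = R.symm i) ↔
          (∀ i : Fin n, (i : ℕ) < j → P.symm i = Q.symm i) ∧ P.symm ⟨j, hj⟩ = x := fun P => by
        constructor
        · intro h
          refine ⟨fun i hi => (h i (by omega)).trans (hRi i hi), (h _ ?_).trans hRj⟩
          simp
        · rintro ⟨h1, h2⟩ i hi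
          rcases Nat.lt_succ_iff_lt_or_eq.1 hi with hi | hi
          · exact (h1 i hi).trans (hRi i hi).symm
          · have : i = ⟨j, hj⟩ := Fin.ext hi
            rw [this, h2, hRj]
      split_ifs with hadm
      · rw [← hseg, ← ih (j + 1) (by omega) R]
        congr 1
        ext P
        simp only [Finset.mem_filter, Finset.mem_univ, true_and]
        constructor
        · rintro ⟨⟨h1, h2⟩, h3⟩
          exact ⟨(agree P).2 ⟨h1, h3⟩, fun l hl => h2 l (by omega)⟩
        · rintro ⟨h1, h2⟩
          refine ⟨⟨((agree P).1 h1).1, fun l hl hln => ?_⟩, ((agree P).1 h1).2⟩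
          rcases Nat.lt_or_ge (j + 1) l with hl' | hl'
          · exact h2 l hl' hln
          · obtain rfl : l = j + 1 := by omega
            rw [initialSegment_congr h1, hseg]
            exact hadm
      · rw [Finset.card_eq_zero, Finset.filter_eq_empty_iff]
        intro P hP h3
        simp only [Finset.mem_filter, Finset.mem_univ, true_and] at hP
        refine hadm ?_
        rw [← hseg, ← initialSegment_congr ((agree P).2 ⟨hP.1, h3⟩)]
        exact hP.2 _ (by omega) (by omega)
    · intro P hP
      simp only [Finset.coe_filter, Finset.mem_univ, true_and, Set.mem_ofPred_eq] at hP
      simp only [Finset.coe_compl, Set.mem_compl_iff, Finset.mem_coe]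
      rw [← initialSegment_congr hP.1]
      simp [initialSegment]

/-- Needed because `completions` tests only the extensions of its starting set. -/
theorem admissible_empty {n : ℕ} (N : Triple n → NeverCondition) : Admissible N ∅ := by
  intro t h
  unfold Violates at h
  have : ∃ k : Fin 3, k ≠ (N t).alt := by
    generalize (N t).alt = i
    revert i; decide
  split_ifs at h
  · simpa using (h (N t).alt).2 rfl
  · obtain ⟨k, hk⟩ := this
    simpa using (h k).2 hk

theorem card_domainOf {n : ℕ} {N : Triple n → NeverCondition}
    (hN : ∀ t, (N t).pos = 0 ∨ (N t).pos = 2) :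
    (domainOf N).card = completions N n ∅ := by
  classical
  have h0 : initialSegment (1 : PrefOrder n) 0 = ∅ := by simp [initialSegment]
  rw [← h0, ← card_agreeing N n 0 rfl 1]
  congr 1
  ext P
  rw [mem_domainOf_iff hN]
  simp only [Finset.mem_filter, Finset.mem_univ, true_and, Nat.not_lt_zero, false_implies,
    implies_true]
  constructor
  · exact fun h l _ hl => h l hl
  · intro h l hl
    rcases Nat.eq_zero_or_pos l with rfl | hpos
    · have : initialSegment P 0 = ∅ := by simp [initialSegment]
      rw [this]
      exact admissible_empty N
    · exact h l hpos hl

/-! ### Schemes of never conditions given by numerical rules -/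

/-- The never condition with number `q`: the `q`-th alternative of the triple is never first for
`q = 0, 1, 2`, and the `(q - 3)`-rd one is never last for `q = 3, 4, 5`. -/
def conditionOf : ℕ → NeverCondition
  | 0 => ⟨0, 0⟩
  | 1 => ⟨1, 0⟩
  | 2 => ⟨2, 0⟩
  | 3 => ⟨0, 2⟩
  | 4 => ⟨1, 2⟩
  | _ => ⟨2, 2⟩

/-- The complete set of never conditions that puts the condition number `r a b c` on the triple
`a < b < c`. -/
def scheme (n : ℕ) (r : ℕ → ℕ → ℕ → ℕ) (t : Triple n) : NeverCondition :=
  conditionOf (r (t 0) (t 1) (t 2))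

theorem conditionOf_pos (q : ℕ) : (conditionOf q).pos = 0 ∨ (conditionOf q).pos = 2 := by
  match q with
  | 0 | 1 | 2 => exact Or.inl rfl
  | 3 | 4 | _ + 5 => exact Or.inr rfl

/-! ### Bit masks -/

/-- Call by value in the kernel: `n` is evaluated to a literal before `f` is applied. -/
noncomputable def force {α : Type} (n : ℕ) (f : ℕ → α) : α :=
  Nat.rec (f 0) (fun k _ => f (Nat.succ k)) n

theorem force_eq {α : Type} (n : ℕ) (f : ℕ → α) : force n f = f n := by
  cases n <;> rfl

/-- The bitwise disjunction of `f 0, …, f (n - 1)`. -/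
noncomputable def lorRange (n : ℕ) (f : ℕ → ℕ) : ℕ :=
  Nat.rec 0 (fun k ih => ih ||| f k) n

theorem testBit_lorRange (n : ℕ) (f : ℕ → ℕ) (j : ℕ) :
    (lorRange n f).testBit j = true ↔ ∃ k < n, (f k).testBit j = true := by
  induction n with
  | zero => simp [lorRange]
  | succ n ih =>
    change (lorRange n f ||| f n).testBit j = true ↔ _
    rw [Nat.testBit_or, Bool.or_eq_true, ih]
    simp only [Nat.lt_succ_iff_lt_or_eq, or_and_right, exists_or, exists_eq_left]

/-- The position of the bit that encodes the triple `(x, y, z)` of numbers less than `n`. -/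
def code (n x y z : ℕ) : ℕ := (x * n + y) * n + z

theorem code_inj {n : ℕ} {x y z x' y' z' : Fin n} :
    code n x y z = code n x' y' z' ↔ x = x' ∧ y = y' ∧ z = z' := by
  have aux : ∀ {a b : ℕ} {u v : Fin n}, a * n + u = b * n + v ↔ a = b ∧ u = v := by
    intro a b u v
    constructor
    · intro h
      have hn : 0 < n := u.pos
      have h1 := congrArg (· / n) h
      have h2 := congrArg (· % n) h
      simp only [Nat.mul_add_mod_of_lt u.2, Nat.mul_add_mod_of_lt v.2] at h2
      simp only [mul_comm _ n, Nat.mul_add_div hn, Nat.div_eq_of_lt u.2, Nat.div_eq_of_lt v.2,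
        add_zero] at h1
      exact ⟨h1, Fin.ext h2⟩
    · rintro ⟨rfl, rfl⟩; rfl
  rw [code, code, aux, aux, and_assoc]
  simp only [Fin.ext_iff]

/-- The bit that forbids the initial segments ruled out by a condition of type `iN1`. -/
def firstBit (n : ℕ) : ℕ → ℕ → ℕ → ℕ → ℕ
  | 0, a, b, c => 2 ^ code n a b c
  | 1, a, b, c => 2 ^ code n b a c
  | 2, a, b, c => 2 ^ code n c a b
  | _, _, _, _ => 0

/-- The bit that forbids the initial segments ruled out by a condition of type `iN3`. -/
def lastBit (n : ℕ) : ℕ → ℕ → ℕ → ℕ → ℕ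
  | 0, _, _, _ => 0
  | 1, _, _, _ => 0
  | 2, _, _, _ => 0
  | 3, a, b, c => 2 ^ code n b c a
  | 4, a, b, c => 2 ^ code n a c b
  | _, a, b, c => 2 ^ code n a b c

theorem forall_fin_three {p : Fin 3 → Prop} : (∀ i, p i) ↔ p 0 ∧ p 1 ∧ p 2 :=
  ⟨fun h => ⟨h 0, h 1, h 2⟩, fun ⟨h0, h1, h2⟩ i => by fin_cases i <;> assumption⟩

/-- Each condition sets one bit, coding the triple with its members in `s` listed first. One
ordering of the two alternatives on the same side suffices, since the quantifiers run over both. -/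
theorem violates_conditionOf {n : ℕ} (s : Finset (Fin n)) (t : Triple n) (q : ℕ) :
    Violates s t (conditionOf q) ↔
      (∃ x ∈ s, ∃ y ∉ s, ∃ z ∉ s,
        (firstBit n q (t 0) (t 1) (t 2)).testBit (code n x y z) = true) ∨
      (∃ x ∈ s, ∃ y ∈ s, ∃ z ∉ s,
        (lastBit n q (t 0) (t 1) (t 2)).testBit (code n x y z) = true) := by
  match q with
  | 0 | 1 | 2 | 3 | 4 | _ + 5 =>
    simp only [Violates, conditionOf, firstBit, lastBit, forall_fin_three, Nat.testBit_two_pow,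
      code_inj, decide_eq_true_eq, Nat.zero_testBit]
    simp <;> tauto

/-- The mask of all bits coming from conditions of type `iN1`. -/
noncomputable def firstMask (n : ℕ) (r : ℕ → ℕ → ℕ → ℕ) : ℕ :=
  lorRange n fun c => lorRange c fun b => lorRange b fun a => firstBit n (r a b c) a b c

/-- The mask of all bits coming from conditions of type `iN3`. -/
noncomputable def lastMask (n : ℕ) (r : ℕ → ℕ → ℕ → ℕ) : ℕ :=
  lorRange n fun c => lorRange c fun b => lorRange b fun a => lastBit n (r a b c) a b c

theorem testBit_lorRange_triples {n : ℕ} (f : ℕ → ℕ → ℕ → ℕ) (j : ℕ) :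
    (lorRange n fun c => lorRange c fun b => lorRange b fun a => f a b c).testBit j = true ↔
      ∃ t : Triple n, (f (t 0) (t 1) (t 2)).testBit j = true := by
  simp only [testBit_lorRange]
  constructor
  · rintro ⟨c, hc, b, hb, a, ha, h⟩
    obtain ⟨t, h0, h1, h2⟩ := exists_triple (n := n) (a := ⟨a, by omega⟩) (b := ⟨b, by omega⟩)
      (c := ⟨c, hc⟩) ha hb
    exact ⟨t, by rw [h0, h1, h2]; exact h⟩
  · rintro ⟨t, h⟩
    have h01 : t 0 < t 1 := t.strictMono (by decide)
    have h12 : t 1 < t 2 := t.strictMono (by decide)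
    exact ⟨t 2, (t 2).2, t 1, h12, t 0, h01, h⟩

/-- Distinct exponents mean that no carries occur, so arithmetic sums act as bitwise unions. -/
theorem testBit_sum_two_pow {ι : Type*} (A : Finset ι) {g : ι → ℕ} (hg : Set.InjOn g A) (j : ℕ) :
    (∑ p ∈ A, 2 ^ g p).testBit j = true ↔ ∃ p ∈ A, g p = j := by
  classical
  rw [← Finset.sum_image (f := fun i => 2 ^ i) hg, ← Nat.mem_bitIndices, ← List.mem_toFinset,
    Finset.toFinset_bitIndices_sum_two_pow, Finset.mem_image]

theorem beq_iff {a b : ℕ} : a.beq b = true ↔ a = b :=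
  ⟨Nat.eq_of_beq_eq_true, fun h => h ▸ Nat.beq_refl a⟩

theorem land_eq_zero_iff (a b : ℕ) :
    a &&& b = 0 ↔ ∀ j, b.testBit j = true → ¬ a.testBit j = true := by
  constructor
  · intro h j hb ha
    have := congrArg (fun m : ℕ => m.testBit j) h
    simp [ha, hb] at this
  · intro h
    refine Nat.eq_of_testBit_eq fun j => ?_
    have := h j
    rw [Nat.testBit_and, Nat.zero_testBit]
    cases ha : a.testBit j <;> cases hb : b.testBit j <;> simp_all

/-- The number whose bits at the multiples `k * i` for `i ∈ s` are set. -/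
def spread {n : ℕ} (k : ℕ) (s : Finset (Fin n)) : ℕ := ∑ i ∈ s, 2 ^ (k * (i : ℕ))

theorem spread_insert {n k : ℕ} {s : Finset (Fin n)} {x : Fin n} (hx : x ∉ s) :
    spread k (insert x s) = spread k s + 2 ^ (k * (x : ℕ)) := by
  rw [spread, Finset.sum_insert hx, add_comm]
  rfl

theorem spread_compl {n k : ℕ} (s : Finset (Fin n)) :
    spread k (Finset.univ : Finset (Fin n)) - spread k s = spread k sᶜ := by
  have : spread k s + spread k sᶜ = spread k (Finset.univ : Finset (Fin n)) :=
    Finset.sum_add_sum_compl s _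
  omega

theorem testBit_spread_one {n : ℕ} (s : Finset (Fin n)) (i : Fin n) :
    (spread 1 s).testBit i = true ↔ i ∈ s := by
  have := testBit_sum_two_pow s (g := fun i : Fin n => 1 * (i : ℕ))
    (fun a _ b _ h => Fin.ext (by simpa using h)) i
  simpa [spread, Fin.val_inj] using this

/-- Multiplying the three spreadings adds exponents to base-`n` codes, all distinct: one product of
integers forms the indicator of `s × t × u`. -/
theorem testBit_spread_mul {n : ℕ} (s t u : Finset (Fin n)) (j : ℕ) :
    (spread (n * n) s * (spread n t * spread 1 u)).testBit j = true ↔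
      ∃ x ∈ s, ∃ y ∈ t, ∃ z ∈ u, code n x y z = j := by
  have e : spread (n * n) s * (spread n t * spread 1 u) =
      ∑ p ∈ s ×ˢ t ×ˢ u, 2 ^ code n p.1 p.2.1 p.2.2 := by
    rw [spread, spread, spread, Finset.sum_product, Finset.sum_mul]
    refine Finset.sum_congr rfl fun x _ => ?_
    rw [Finset.sum_product, Finset.sum_mul, Finset.mul_sum]
    refine Finset.sum_congr rfl fun y _ => ?_
    rw [Finset.mul_sum, Finset.mul_sum]
    refine Finset.sum_congr rfl fun z _ => ?_
    rw [← pow_add, ← pow_add, code]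
    congr 1
    ring
  rw [e, testBit_sum_two_pow]
  · simp only [Finset.mem_product, Prod.exists]
    constructor
    · rintro ⟨x, y, z, ⟨hx, hy, hz⟩, h⟩; exact ⟨x, hx, y, hy, z, hz, h⟩
    · rintro ⟨x, hx, y, hy, z, hz, h⟩; exact ⟨x, y, z, ⟨hx, hy, hz⟩, h⟩
  · rintro ⟨x, y, z⟩ _ ⟨x', y', z'⟩ _ h
    obtain ⟨rfl, rfl, rfl⟩ := code_inj.1 h
    rfl

/-- The admissibility test on bit masks. -/
def passes (first last full wideFull set wide wider : ℕ) : Bool :=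
  (first &&& (wider * ((wideFull - wide) * (full - set)))).beq 0 &&
    (last &&& (wider * (wide * (full - set)))).beq 0

/-- The products enumerate the triples with one, respectively two, leading members in `s`, and
disjointness from the masks says that none is forbidden. All triples are tested at once. -/
theorem passes_iff {n : ℕ} (r : ℕ → ℕ → ℕ → ℕ) (s : Finset (Fin n)) :
    passes (firstMask n r) (lastMask n r) (spread 1 (Finset.univ : Finset (Fin n)))
      (spread n (Finset.univ : Finset (Fin n))) (spread 1 s) (spread n s) (spread (n * n) s) =
        true ↔ Admissible (scheme n r) s := by
  simp only [passes, Bool.and_eq_true, beq_iff, spread_compl, land_eq_zero_iff,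
    testBit_spread_mul, Admissible, scheme, violates_conditionOf, firstMask, lastMask,
    testBit_lorRange_triples]
  constructor
  · rintro ⟨h1, h2⟩ t (⟨x, hx, y, hy, z, hz, h⟩ | ⟨x, hx, y, hy, z, hz, h⟩)
    · exact h1 _ ⟨x, hx, y, by simpa using hy, z, by simpa using hz, rfl⟩ ⟨t, h⟩
    · exact h2 _ ⟨x, hx, y, hy, z, by simpa using hz, rfl⟩ ⟨t, h⟩
  · intro h
    constructor
    · rintro _ ⟨x, hx, y, hy, z, hz, rfl⟩ ⟨t, ht⟩
      exact h t (Or.inl ⟨x, hx, y, by simpa using hy, z, by simpa using hz, ht⟩)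
    · rintro _ ⟨x, hx, y, hy, z, hz, rfl⟩ ⟨t, ht⟩
      exact h t (Or.inr ⟨x, hx, y, hy, z, by simpa using hz, ht⟩)

/-! ### Counting the chains level by level -/

/-- An admissible set, given by three spreadings of its bit mask, together with a number of chains
that lead to it. -/
structure Node where
  /-- The bit mask of the set. -/
  set : ℕ
  /-- The mask with its bits moved to the multiples of `n`. -/
  wide : ℕ
  /-- The mask with its bits moved to the multiples of `n * n`. -/
  wider : ℕ
  /-- The number of chains. -/
  count : ℕ

/-- Insert a node, adding up the numbers of chains of nodes with the same set. -/
noncomputable def insertNode (e : Node) (L : List Node) : List Node :=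
  List.rec [e] (fun d tl ih => bif d.set.beq e.set then
    ⟨d.set, d.wide, d.wider, d.count + e.count⟩ :: tl else d :: ih) L

/-- Insert all one-element extensions of the set of `e` by an element less than `k`. -/
noncomputable def expand (ok : ℕ → ℕ → ℕ → Bool) (n : ℕ) (e : Node) (acc : List Node) (k : ℕ) :
    List Node :=
  Nat.rec acc (fun x ih => bif e.set.testBit x then ih else
    force (e.set + 2 ^ (1 * x)) fun m => force (e.wide + 2 ^ (n * x)) fun u =>
      force (e.wider + 2 ^ (n * n * x)) fun v =>
        bif ok m u v then insertNode ⟨m, u, v, e.count⟩ ih else ih) k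

/-- The nodes of the next level. -/
noncomputable def nextLevel (ok : ℕ → ℕ → ℕ → Bool) (n : ℕ) (L : List Node) : List Node :=
  List.rec [] (fun e _ ih => expand ok n e ih n) L

/-- Call by value in the kernel for lists of nodes. -/
noncomputable def forceNodes {α : Type} (L : List Node) (f : List Node → α) : α :=
  List.rec (motive := fun _ => (List Node → α) → α) (fun f => f [])
    (fun e _ ih f => force e.set fun m => force e.wide fun u => force e.wider fun v =>
      force e.count fun c => ih fun tl => f (⟨m, u, v, c⟩ :: tl)) L f

/-- The total number of chains. -/
noncomputable def totalCount (L : List Node) : ℕ :=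
  List.rec 0 (fun e _ ih => e.count + ih) L

/-- The number of chains after `k` further levels. -/
noncomputable def countChains (ok : ℕ → ℕ → ℕ → Bool) (n k : ℕ) (L : List Node) : ℕ :=
  Nat.rec (motive := fun _ => List Node → ℕ) totalCount
    (fun _ ih L => forceNodes (nextLevel ok n L) ih) k L

/-- The mask with the first `n` multiples of `k` set. -/
noncomputable def fullMask (k n : ℕ) : ℕ := Nat.rec 0 (fun x ih => ih + 2 ^ (k * x)) n

/-- The size of the domain of the scheme given by `r`. -/
noncomputable def domainSize (n : ℕ) (r : ℕ → ℕ → ℕ → ℕ) : ℕ :=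
  force (firstMask n r) fun first => force (lastMask n r) fun last =>
    force (fullMask 1 n) fun full => force (fullMask n n) fun wideFull =>
      countChains (passes first last full wideFull) n n [⟨0, 0, 0, 1⟩]

/-! ### Correctness of the level-by-level count -/

theorem fullMask_eq (k n : ℕ) : fullMask k n = spread k (Finset.univ : Finset (Fin n)) := by
  have : ∀ m, fullMask k m = ∑ x ∈ Finset.range m, 2 ^ (k * x) := fun m => by
    induction m with
    | zero => rfl
    | succ m ih => rw [Finset.sum_range_succ, ← ih]; rfl
  rw [this, spread, Finset.sum_range]

theorem forceNodes_eq {α : Type} (L : List Node) (f : List Node → α) : forceNodes L f = f L := by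
  induction L generalizing f with
  | nil => rfl
  | cons e L ih =>
    change (force e.set fun m => force e.wide fun u => force e.wider fun v =>
      force e.count fun c => forceNodes L fun tl => f (⟨m, u, v, c⟩ :: tl)) = _
    simp only [force_eq, ih]

/-- The set with bit mask `m`. -/
def setOfMask (n m : ℕ) : Finset (Fin n) := Finset.univ.filter fun i => m.testBit i = true

theorem setOfMask_spread {n : ℕ} (s : Finset (Fin n)) : setOfMask n (spread 1 s) = s := by
  ext i
  simp [setOfMask, testBit_spread_one]

/-- The masks of the node belong to one and the same set. -/
def Node.Valid (n : ℕ) (e : Node) : Prop :=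
  ∃ s : Finset (Fin n), e.set = spread 1 s ∧ e.wide = spread n s ∧ e.wider = spread (n * n) s

/-- The number of chains through the nodes of a list that can be completed by `k` more sets. -/
noncomputable def weight {n : ℕ} (N : Triple n → NeverCondition) (k : ℕ) (L : List Node) : ℕ :=
  (L.map fun e => e.count * completions N k (setOfMask n e.set)).sum

theorem insertNode_cons (e d : Node) (L : List Node) :
    insertNode e (d :: L) = bif d.set.beq e.set then
      ⟨d.set, d.wide, d.wider, d.count + e.count⟩ :: L else d :: insertNode e L := rfl

theorem insertNode_valid {n : ℕ} {e : Node} {L : List Node} (he : e.Valid n)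
    (hL : ∀ d ∈ L, d.Valid n) : ∀ d ∈ insertNode e L, d.Valid n := by
  induction L with
  | nil => simpa [insertNode] using he
  | cons d L ih =>
    rw [insertNode_cons]
    have hd := hL d List.mem_cons_self
    have hL' := fun d hd => hL d (List.mem_cons_of_mem _ hd)
    cases d.set.beq e.set
    · intro f hf
      rcases List.mem_cons.1 hf with rfl | hf
      · exact hd
      · exact ih hL' f hf
    · intro f hf
      rcases List.mem_cons.1 hf with rfl | hf
      · exact hd
      · exact hL' f hf

/-- Merging nodes is harmless because the number of completions depends on the set alone. -/
theorem weight_insertNode {n : ℕ} (N : Triple n → NeverCondition) (k : ℕ) (e : Node)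
    (L : List Node) : weight N k (insertNode e L) =
      weight N k L + e.count * completions N k (setOfMask n e.set) := by
  induction L with
  | nil => simp [insertNode, weight]
  | cons d L ih =>
    rw [insertNode_cons]
    cases h : d.set.beq e.set
    · simp only [cond_false]
      simp only [weight, List.map_cons, List.sum_cons] at ih ⊢
      rw [ih]; ring
    · rw [beq_iff] at h
      simp only [cond_true, weight, List.map_cons, List.sum_cons, h]
      ring

open Classical in
/-- What the extension of `s` by `x` contributes to the number of completions of `s`. -/
noncomputable def extensionCount {n : ℕ} (N : Triple n → NeverCondition) (k : ℕ)
    (s : Finset (Fin n)) (x : ℕ) : ℕ :=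
  if h : x < n then
    if (⟨x, h⟩ : Fin n) ∉ s ∧ Admissible N (insert ⟨x, h⟩ s) then
      completions N k (insert ⟨x, h⟩ s) else 0
  else 0

theorem sum_extensionCount {n : ℕ} (N : Triple n → NeverCondition) (k : ℕ) (s : Finset (Fin n)) :
    ∑ x ∈ Finset.range n, extensionCount N k s x = completions N (k + 1) s := by
  classical
  have : ∀ x : Fin n, extensionCount N k s x =
      if x ∈ sᶜ then (if Admissible N (insert x s) then completions N k (insert x s) else 0)
        else 0 := fun x => by
    simp only [extensionCount, x.2, dif_pos, Finset.mem_compl, ← ite_and]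
  rw [Finset.sum_range, completions]
  simp only [this]
  rw [Finset.sum_ite_mem, Finset.univ_inter]

theorem expand_succ (ok : ℕ → ℕ → ℕ → Bool) (n : ℕ) (e : Node) (acc : List Node) (x : ℕ) :
    expand ok n e acc (x + 1) = bif e.set.testBit x then expand ok n e acc x else
      bif ok (e.set + 2 ^ (1 * x)) (e.wide + 2 ^ (n * x)) (e.wider + 2 ^ (n * n * x)) then
        insertNode ⟨e.set + 2 ^ (1 * x), e.wide + 2 ^ (n * x), e.wider + 2 ^ (n * n * x),
          e.count⟩ (expand ok n e acc x) else expand ok n e acc x := by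
  have : expand ok n e acc (x + 1) = bif e.set.testBit x then expand ok n e acc x else
      force (e.set + 2 ^ (1 * x)) fun m => force (e.wide + 2 ^ (n * x)) fun u =>
        force (e.wider + 2 ^ (n * n * x)) fun v =>
          bif ok m u v then insertNode ⟨m, u, v, e.count⟩ (expand ok n e acc x)
            else expand ok n e acc x := rfl
  rw [this]
  simp only [force_eq]

/-- The test `ok` decides admissibility with respect to `N`. -/
def Decides {n : ℕ} (N : Triple n → NeverCondition) (ok : ℕ → ℕ → ℕ → Bool) : Prop :=
  ∀ s : Finset (Fin n),
    ok (spread 1 s) (spread n s) (spread (n * n) s) = true ↔ Admissible N s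

theorem expand_spec {n : ℕ} {N : Triple n → NeverCondition} {ok : ℕ → ℕ → ℕ → Bool}
    (hok : Decides N ok) (k : ℕ) {e : Node} (he : e.Valid n) {acc : List Node}
    (hacc : ∀ d ∈ acc, d.Valid n) (x : ℕ) (hx : x ≤ n) :
    (∀ d ∈ expand ok n e acc x, d.Valid n) ∧ weight N k (expand ok n e acc x) =
      weight N k acc +
        e.count * ∑ y ∈ Finset.range x, extensionCount N k (setOfMask n e.set) y := by
  induction x with
  | zero => exact ⟨hacc, by simp [expand]⟩
  | succ x ih =>
    obtain ⟨ih1, ih2⟩ := ih (by omega)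
    obtain ⟨s, h1, h2, h3⟩ := he
    have hxn : x < n := by omega
    have hbit := testBit_spread_one s ⟨x, hxn⟩
    rw [expand_succ, Finset.sum_range_succ, extensionCount, dif_pos hxn]
    rw [h1, setOfMask_spread] at ih2 ⊢
    by_cases hxs : (⟨x, hxn⟩ : Fin n) ∈ s
    · have hb : (spread 1 s).testBit x = true := hbit.2 hxs
      rw [hb, cond_true, if_neg (fun h => h.1 hxs), add_zero]
      exact ⟨ih1, ih2⟩
    · have hb : (spread 1 s).testBit x = false := by
        rw [← Bool.not_eq_true]; exact mt hbit.1 hxs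
      have hins : ∀ j, spread j s + 2 ^ (j * x) = spread j (insert (⟨x, hxn⟩ : Fin n) s) :=
        fun j => (spread_insert hxs).symm
      rw [hb, cond_false, h2, h3, hins, hins, hins]
      by_cases hadm : Admissible N (insert (⟨x, hxn⟩ : Fin n) s)
      · rw [(hok _).2 hadm, cond_true, if_pos ⟨hxs, hadm⟩]
        refine ⟨insertNode_valid ⟨_, rfl, rfl, rfl⟩ ih1, ?_⟩
        rw [weight_insertNode, ih2, setOfMask_spread]
        ring
      · rw [Bool.not_eq_true _ |>.mp (mt (hok _).1 hadm), cond_false, if_neg fun h => hadm h.2,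
          add_zero]
        exact ⟨ih1, ih2⟩

/-- The invariant of the computation: passing to the next level trades one remaining step for
updated chain counts and preserves the weight. -/
theorem nextLevel_spec {n : ℕ} {N : Triple n → NeverCondition} {ok : ℕ → ℕ → ℕ → Bool}
    (hok : Decides N ok) (k : ℕ) {L : List Node} (hL : ∀ d ∈ L, d.Valid n) :
    (∀ d ∈ nextLevel ok n L, d.Valid n) ∧
      weight N k (nextLevel ok n L) = weight N (k + 1) L := by
  induction L with
  | nil => exact ⟨by simp [nextLevel], rfl⟩
  | cons e L ih =>
    obtain ⟨ih1, ih2⟩ := ih fun d hd => hL d (List.mem_cons_of_mem _ hd)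
    have h := expand_spec hok k (hL e List.mem_cons_self) ih1 n le_rfl
    refine ⟨h.1, h.2.trans ?_⟩
    rw [ih2, sum_extensionCount, add_comm]
    rfl

theorem countChains_eq {n : ℕ} {N : Triple n → NeverCondition} {ok : ℕ → ℕ → ℕ → Bool}
    (hok : Decides N ok) (k : ℕ) {L : List Node} (hL : ∀ d ∈ L, d.Valid n) :
    countChains ok n k L = weight N k L := by
  induction k generalizing L with
  | zero =>
    clear hL
    induction L with
    | nil => rfl
    | cons e L ih =>
      change e.count + countChains ok n 0 L = _
      rw [ih]
      simp [weight, completions]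
  | succ k ih =>
    change forceNodes (nextLevel ok n L) (countChains ok n k) = _
    rw [forceNodes_eq, ih (nextLevel_spec hok k hL).1, (nextLevel_spec hok k hL).2]

theorem card_domainOf_scheme (n : ℕ) (r : ℕ → ℕ → ℕ → ℕ) :
    (domainOf (scheme n r)).card = domainSize n r := by
  rw [card_domainOf (N := scheme n r) fun t => conditionOf_pos _]
  simp only [domainSize, force_eq, fullMask_eq]
  rw [countChains_eq (passes_iff r) n fun d hd => ?_]
  · have : setOfMask n 0 = ∅ := by simp [setOfMask]
    simp [weight, this]
  · rw [List.mem_singleton.1 hd]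
    exact ⟨∅, by simp [spread], by simp [spread], by simp [spread]⟩

theorem isPeakPitDomain_scheme (n : ℕ) (r : ℕ → ℕ → ℕ → ℕ) :
    IsPeakPitDomain (domainOf (scheme n r)) :=
  isPeakPitDomain_domainOf fun _ => conditionOf_pos _

/-- The rule of Fishburn's alternating scheme. -/
def alternatingRule (_ b _ : ℕ) : ℕ := bif (b % 2).beq 0 then 4 else 1

theorem alternatingScheme_eq (n : ℕ) : alternatingScheme n = scheme n alternatingRule := by
  funext t
  unfold alternatingScheme scheme alternatingRule
  -- Alternatives are stored from 0, so parity is reversed relative to the scheme on `{1, …, n}`.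
  rcases Nat.mod_two_eq_zero_or_one (t 1) with h | h
  · rw [if_neg (by rw [Nat.even_iff]; omega), h]; rfl
  · rw [if_pos (by rw [Nat.even_iff]; omega), h]; rfl

theorem card_fishburnDomain (n : ℕ) : (fishburnDomain n).card = domainSize n alternatingRule := by
  rw [fishburnDomain, alternatingScheme_eq, card_domainOf_scheme]

/-- The rule whose values are the octal digits of `T`, the triples being enumerated
colexicographically. -/
def tableRule (T a b c : ℕ) : ℕ :=
  (T >>> (3 * (c * (c - 1) * (c - 2) / 6 + b * (b - 1) / 2 + a))) % 8

/-! ### Large peak-pit domains and Fishburn domains -/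

/-- The table needs no further certificate: any literal defines a peak-pit domain, and only the size
has to be computed. -/
theorem exists_peakPitDomain_9 :
    ∃ D : Finset (PrefOrder 9), IsPeakPitDomain D ∧ D.card = 492 := by
  refine ⟨_, isPeakPitDomain_scheme 9 (tableRule 0x9b6da6db69249a6934a224925b6db4d26944db6da6934a269a4d28928e4725), ?_⟩
  rw [card_domainOf_scheme]
  decide +kernel

theorem exists_peakPitDomain_10 :
    ∃ D : Finset (PrefOrder 10), IsPeakPitDomain D ∧ D.card = 1104 := by
  refine ⟨_, isPeakPitDomain_scheme 10 (tableRule 0x9b6db4db6da4924d24d252451224924b6db6d24d25245126db6da49a4a48a24d24d25245129229144e4a2d169), ?_⟩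
  rw [card_domainOf_scheme]
  decide +kernel

theorem exists_peakPitDomain_11 :
    ∃ D : Finset (PrefOrder 11), IsPeakPitDomain D ∧ D.card = 2452 := by
  refine ⟨_, isPeakPitDomain_scheme 11 (tableRule 0x5a4924905b6db24924b6db6d24d252451205b6db24924b6db6d24d25245124db6da4924d24d25245126db6da49a4a48a24d24d25245129229144e4a2d169), ?_⟩
  rw [card_domainOf_scheme]
  decide +kernel

theorem exists_peakPitDomain_12 :
    ∃ D : Finset (PrefOrder 12), IsPeakPitDomain D ∧ D.card = 5520 := by
  refine ⟨_, isPeakPitDomain_scheme 12 (tableRule 0x24d249249adb6d9adb6d86db6c924969269292289129b6db69b6db4db6da4924d24d25245126924924924936db6d24d25245128924936db6d24d25245126db6da49a4a48a24d24d25245129229144e4a2d169), ?_⟩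
  rw [card_domainOf_scheme]
  decide +kernel

theorem exists_peakPitDomain_13 :
    ∃ D : Finset (PrefOrder 13), IsPeakPitDomain D ∧ D.card = 12182 := by
  refine ⟨_, isPeakPitDomain_scheme 13 (tableRule 0x934924924d6db6d9adb6db0db6db24924c49a4934a29148942536db6da6db6da6db6da4924a24d249a5148a44a34924924924926db6dc49a4934a29148948924926db6dc49a4934a29148946db6dc49a4934a291489489349269452291284936391c1208e472492c168a28), ?_⟩
  rw [card_domainOf_scheme]
  decide +kernel

theorem exists_peakPitDomain_14 :
    ∃ D : Finset (PrefOrder 14), IsPeakPitDomain D ∧ D.card = 27026 := by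
  refine ⟨_, isPeakPitDomain_scheme 14 (tableRule 0x9244924922096db6d82db6db64924925b6db6db6db7126924d28a452250825b6db6096db6d92492492db6db6db6dc49a4934a291489445a4924926db6db4924924924a24d249a5148a44a26db6db49249249249449a4934a29148946db6db6db6dc49a4934a291489449249449a4934a291489489349269452291284936391c1208e472492c168a28), ?_⟩
  rw [card_domainOf_scheme]
  decide +kernel

theorem exists_peakPitDomain_15 :
    ∃ D : Finset (PrefOrder 15), IsPeakPitDomain D ∧ D.card = 59430 := by
  refine ⟨_, isPeakPitDomain_scheme 15 (tableRule 0x9225b6db6e449249248a4924924924924946db6db6db6db4a28a45144a26944d349a9126db6db2936db6da4db6db7124924924924928a291451289a5134d268924924924924924c6db6db6db6db4a28a45144a26944d349a4924924a36db6db6db6da5145228a25134a269a4d46db6db6db6db4a28a45144a26944d349a2492494a28a45144a26944d349a4a28a45144a26944d349a965968a6d14d369b45368a69b4d01ba4b6ab64a6d2), ?_⟩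
  rw [card_domainOf_scheme]
  decide +kernel

theorem exists_peakPitDomain_16 :
    ∃ D : Finset (PrefOrder 16), IsPeakPitDomain D ∧ D.card = 131536 := by
  refine ⟨_, isPeakPitDomain_scheme 16 (tableRule 0x36d2492492400db6db6d80db6db6d86db6db6c924924949a6a34d271269a89469489c8928924da4006db6db6c06db6db6c36db6db64924924a4d351a6938934d44a34a44e44944926d2b4924924924924924b6db6db6934d469a4e24d35128d291391251249b4892492492db6db6da4d351a6938934d44a34a44e44944926d26db6db6d269a8d349c49a6a251a5227224a24936924d351a6938934d44a34a44e44944926d26db01b49c0a35044a08a052b64a4988a34244808a45292da6c015890090534db2012012d34d82c14934da6d6d2), ?_⟩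
  rw [card_domainOf_scheme]
  decide +kernel

theorem exists_peakPitDomain_17 :
    ∃ D : Finset (PrefOrder 17), IsPeakPitDomain D ∧ D.card = 292015 := by
  refine ⟨_, isPeakPitDomain_scheme 17 (tableRule 0xd34db6db6d94536db6db6a26db6db6d34924924936db6db6924924924da51a69389349c4a34a44948a25126d26592492492624924924926db6db6da49249249b6db6db49b4a34d271269b8946948929144a24da4a24934924936db6db6d24924924db6db6da4da51a69389349c4a34a44948a25126d2a5b6db6db24924924b6db6db6936d469a4e24d27128d291252289449b49b6db6db6924924924da51a69389349c4a34a44948a25126d26db6db6d26d28d349c49a4e251a5224a45128936924da51a69389349c4a34a44948a25126d26db01b49c0a35044a48a052b64a4988a34244848a45292da6c001810490534db2410012d34d96cb4936926d6d2), ?_⟩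
  rw [card_domainOf_scheme]
  decide +kernel

theorem exists_peakPitDomain_18 :
    ∃ D : Finset (PrefOrder 18), IsPeakPitDomain D ∧ D.card = 649079 := by
  refine ⟨_, isPeakPitDomain_scheme 18 (tableRule 0x8948124924922590db6db6db5036db6db6a06db6db6e04924924836db6db64a24924a4da51a69389349a4a34a46948825126d2269adb65b6d9a036db6db6006db6db6ed24924926b6db6db64924924a4da51a69389349c4a34a44948a25126d26a24924924944924924928db6db6da49249249b6db6db49b4a34d27126939146948929144a24da5044924924806db6db6e92492492db6db6da4da51a69389349c4a34a44948a25126d2a1b6db6dba4924924b6db6db69369469a4e24d27128d291252289449b4ab6db6db64924924a4da51a69389349c4a34a44948a25126d26db6db6d26d28d349c49a4e251a5224844128936924d251a69389351c4a34a44948a24d26d26db01b49c0a35044a48a052b64a4988a34244848a45292da6c001810490534db2410012d34d96cb4936926d6d2), ?_⟩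
  rw [card_domainOf_scheme]
  decide +kernel

theorem exists_peakPitDomain_19 :
    ∃ D : Finset (PrefOrder 19), IsPeakPitDomain D ∧ D.card = 1432836 := by
  refine ⟨_, isPeakPitDomain_scheme 19 (tableRule 0x69a6db6db69b28a6db6db6db5136db6db6da69269249249b6db6db6d24924924936dc4d44db6a26a491489292251252292491489a6934e44a26592492492498924924924926db6db6db69249249249b6db6db6d36dc4d44db6a26a491489292251252292491489a6934d44a25124924924926db6db6db69249249249b6db6db6d36dc4d44db6a26a491489290251252292491489a6934d44a2a5b6db6db6c928924924b6db6db6da6db89a89b6d44d49229125244a24a45249229134d269a8944db6db6db6d24924924936dc4d44db6a26a491489292251252292491489a6934d44a26db6db69b4db7135136da89a9245224a48944948a492452269a4d35128936dc4d44db6a26a491489292251252292491489a6934d44a26db01b014422822802822114104504ac9acd2a402a8808a05208a050450411414b34ba50125b00000b45b6800016d269368b45a00000b6db4da4d268b45000029a6d34d168b4d369a68b456db8a289451202d), ?_⟩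
  rw [card_domainOf_scheme]
  decide +kernel

theorem exists_peakPitDomain_20 :
    ∃ D : Finset (PrefOrder 20), IsPeakPitDomain D ∧ D.card = 3155366 := by
  refine ⟨_, isPeakPitDomain_scheme 20 (tableRule 0x1b01b6db6db6a974b2c964925966b2db6db6d20136db65b6e4692292492acb6db4db6c92494494924924926db6db6d36d28db49c49a4e251a5228a44928936956692c94db6cb64d2c92492495226924924900d36db6db74b24924924b6cb6db6d36db6db6924924924da51a69389351c4a34a44908a25126d26ca6db6db6da5126db6db6dc4d245249249b6d36db6d24994d249249a6924db6db6da89251a6a38934a45234a45148a25126d44a26934924928d365b6db4924924924db6db65b6d36db6db69a4924924da51a69489349c4a37224948a25126d201b6db6db6e96492492496db65b6da6db6db6d249249249b4a34d25126938946948929144a24da5596db6db6d92492c92524924924db6db6da4da51a69389351c4a34a44948925126d26db4db6cb4db6db6ca4d269249369469a4e24d27128d291251489449b4924924924db6db6d24da51a6da89349a4a34944928e25124d36db6db6926d28d249c49a4e251b5224a44928926924da51a69389349c4a34a44948a25126d26db01b49c0a35044a488052b64a4988a34244848a45292da6c001810490534db2410012d34d82cb4d36926d6d2), ?_⟩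
  rw [card_domainOf_scheme]
  decide +kernel

/-- From here on the domains are larger than the sizes asked for, which are later reached by taking
subsets. -/
theorem exists_peakPitDomain_21 :
    ∃ D : Finset (PrefOrder 21), IsPeakPitDomain D ∧ D.card = 7296352 := by
  refine ⟨_, isPeakPitDomain_scheme 21 (tableRule 0x1341269249249249a0d249249249289449249249252249249249249a49249249349249249249b6db6db6db6db6db6d36dc4d44db6a26a491489292251252292491489a6934d44a26c06db6db6db6d08a24924924909136db6db6d924924924925b6db6db6db4db6db6db69249249249b6e26a26db5135248a44949128929149248a44d349a6a25128146db6db6db8224924924920db6db6db6d924924924929249249249b6db6db6d36dc4d44db6a26a491489292251252292491489a6934d44a20006db6db6dba69249249249adb6db6db75b6db6db6c92492492536dc4d44db6a26a491489292251252292491489a6934d44a2b4b6db6db6dd24924924934924924925b6db6db6d36dc4d44db6a26a491489292251252292491489a6934d44a26db6db6db6d36db6db6da4924924926db89a89b6d44d49229125244a24a45249229134d269a89449249249249b6db6db6d36dc4d44db6a26a491489292251252292491489a6934d44a26db6db6db4db7135136da89a9245224a48944948a492452269a4d35128936dc4d44db6a26a491489292251252292491489a6934d44a26db01b014422822802822114104504ac9acd2a402a8808a05208a050450411414b34ba50125b00000b45b68000169269368b45a00000b6db4da4d268b45000029a6d34d168b4d369a68b456db4a289451202d),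 ?_⟩
  rw [card_domainOf_scheme]
  decide +kernel

theorem exists_peakPitDomain_22 :
    ∃ D : Finset (PrefOrder 22), IsPeakPitDomain D ∧ D.card = 16153152 := by
  refine ⟨_, isPeakPitDomain_scheme 22 (tableRule 0x1b01b6db6db6dba5d2c924924924966b2db6db6db6804db6db6db6e46924924924ab2db6db6db6c924924924a4924924926db6db6db4db7135136da89a9245224a48944948a492452269a4d35128ab3496db6db6db6c9a5924924924a91349249249201a6db6db6dba592492492496db6db6db69b6db6db6d24924924936dc4d44db6a26a491489292251252292491489a6934d44a26ca6db6db6db6d449b6db6db6dc4d24924924926db6db6db6d24924924924924924924db6db6db69b6e26a26db5135248a44949128929149248a44d349a6a251251349249249251a6db6db6db4924924924936db6db6db69b6db6db6d24924924936dc4d44db6a26a491489292251252292491489a6934d44a201b6db6db6dba592492492496db6db6db69b6db6db6d24924924936dc4d44db6a26a491489292251252292491489a6934d44a2acb6db6db6db24924924929249249249b6db6db6d36dc4d44db6a26a491489292251252292491489a6934d44a26db6db6db6d36db6db6da4924924926db89a89b6d44d49229125244a24a45249229134d269a89449249249249b6db6db6d36dc4d44db6a26a491489292251252292491489a6934d44a26db6db6db4db7135136da89a9245224a48944948a492452269a4d35128936dc4d44db6a26a491489292251252292491489a6934d44a26db01b014422822802822114104504ac9acd2a402a8808a05208a050450411414b34ba50125b00000b45b68000169269368b45a00000b6db4da4d268b45000029a6d34d168b4d369a68b456db4a289451202d),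 ?_⟩
  rw [card_domainOf_scheme]
  decide +kernel

theorem exists_peakPitDomain_23 :
    ∃ D : Finset (PrefOrder 23), IsPeakPitDomain D ∧ D.card = 34360412 := by
  refine ⟨_, isPeakPitDomain_scheme 23 (tableRule 0x36036db6db6db6e974b24924924924b3596db6db6db6804db6db6db6dc8d2492492492acb6db6db6db64924924924a4924924924db6db6db6d24925125226dc4d449a7135145228e44a28e292472449449a8934d4492acd25b6db6db6db64d2c924924924a9134924924924034db6db6db6e964924924924b6db6db6db69b6db6db6da49249249249249449489b71351269c4d45148a39128a38a491c9125126a24d351249b29b6db6db6db6a24db6db6db6dc4d24924924924db6db6db6db4924924924924924924924db6db6db6d24925125226dc4d449a7135145228e44a28e292472449449a8934d44924a269249249249469b6db6db6da4924924924936db6db6db6d36db6db6db4924924924924928929136e26a24d389a8a29147225147149239224a24d449a6a24900db6db6db6dba592492492492db6db6db6da6db6db6db6924924924924925125226dc4d449a7135145228e44a28e292472449449a8934d4492acb6db6db6db64924924924a4924924924db6db6db6d24925125226dc4d449a7135145228e44a28e292472449449a8934d44926db6db6db6da6db6db6db6924924924924925125226dc4d449a7135145228e44a28e292472449449a8934d449249249249249b6db6db6da4924a24a44db89a8934e26a28a451c89451c5248e489289351269a8924db6db6db6d24925125226dc4d449a7135145228e44a28e292472449449a8934d449249249449489b71351269c4d45148a39128a38a491c9125126a24d35124836d80d80d962b62a5204806a08e040480409415b149a5c005259b49b53802522424624112104484a482dd2c490a5004a44848c440481089094905ba588216050c0004945b4db4914924d00592072015816b16ba5db2502d00db4d22916db49149a581056c362485c41312d),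 ?_⟩
  rw [card_domainOf_scheme]
  decide +kernel

theorem exists_peakPitDomain_24 :
    ∃ D : Finset (PrefOrder 24), IsPeakPitDomain D ∧ D.card = 80029696 := by
  refine ⟨_, isPeakPitDomain_scheme 24 (tableRule 0x6c06db6db6db6e9acd2c924924924d2dd2c924924924d669649249249259a592492492494244924924924228db6db6db7492492492496db6db6db6d24924924936db6db6da6db89a89b6d44d49229125244a24a45249229134d269a89454d6cd2c92492492692cd2c9249249269669649249249259a5924924924a8226db6db6db814492492492adb6db6db6d924924924929b6db6db6d24924924936dc4d44db6a26a491489292251252292491489a6934d44a245b6db49249249249a4924924924936db69249249249491b6db6db6d489249249249349249249249b6db6db6da6db6db6db6db6db6db4db7135136da89a9245224a48944948a492452269a4d35128936db6924924924d24924924924928944924924928a46db6db6db4d36db6db6da69249249249b6db6db6db6db6db6d36dc4d44db6a26a491489292251252292491489a6934d44a26db6db6db6db6d45124924924928a249249249269b6db6db6d349249249249249249249249249249b6e26a26db5135248a44949128929149248a44d349a6a25128a24924924925144924924924d24924924926db6db6db6924924924924924924936dc4d44db6a26a491489292251252292491489a6934d44a20006db6db6dbb4924924924d2db6db6db7492492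4925b6db6db6d36dc4d44db6a26a491489292251252292491489a6934d44a2a6b6db6db6d9a4924924935b6db6db6c92492492536dc4d44db6a26a491489292251252292491489a6934d44a26db6db6db6d24924924936db6db6da6db89a89b6d44d49229125244a24a45249229134d269a89449b6db6db6d24924924936dc4d44db6a26a491489292251252292491489a6934d44a26db6db6db4db7135136da89a9245224a48944948a492452269a4d35128936dc4d44db6a26a491489292251252292491489a6934d44a26db01b014422822802822114104504ac9acd2a402a8808a05208a050450411414b34ba50125b00000b45b68000169269368b45a00000b6db4da4d268b45000029a6d34d168b4d369a68b456db4a289451202d), ?_⟩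
  rw [card_domainOf_scheme]
  decide +kernel

theorem exists_peakPitDomain_25 :
    ∃ D : Finset (PrefOrder 25), IsPeakPitDomain D ∧ D.card = 170157096 := by
  refine ⟨_, isPeakPitDomain_scheme 25 (tableRule 0x6c06db6db6db6dd359a5924924924934b74b24924924926b34b249249249259a592492492492848924924924908a36db6db6dba492492492496db6db6db6da4924924924db6db6db6d24925125226dc4d449a7135145228e44a28e292472449449a8934d4492a6b6696492492492692cd2c924924924d2cd2c92492492496696492492492541136db6db6db81449249249255b6db6db6db6492492492494db6db6db6d24924924924924a24a44db89a8934e26a28a451c89451c5248e489289351269a89248b6db69249249249269249249249249b6db49249249249491b6db6db6da9124924924924d24924924924db6db6db6da6db6db6db6db6db6db6d24925125226dc4d449a7135145228e44a28e292472449449a8934d44924db6da4924924926924924924924928944924924925148db6db6db6d34db6db6db6d349249249249b6db6db6db6db6db6db49249449489b71351269c4d45148a39128a38a491c9125126a24d351249b6db6db6db6db6a28924924924928a24924924924d36db6db6db4d24924924924924924924924924924924925125226dc4d449a7135145228e44a28e292472449449a8934d44925144924924924945124924924926924924924926db6db6db6d24924924924924924924924928929136e26a24d389a8a2914722514714923922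4a24d449a6a24900036db6db6dbb49249249249a5b6db6db6dd2492492492db6db6db6d24925125226dc4d449a7135145228e44a28e292472449449a8934d4492a6b6db6db6db34924924924d6db6db6db6492492492524925125226dc4d449a7135145228e44a28e292472449449a8934d44926db6db6db6da4924924924db6db6db6d24925125226dc4d449a7135145228e44a28e292472449449a8934d44924db6db6db6d24924924924924a24a44db89a8934e26a28a451c89451c5248e489289351269a8924db6db6db6d24925125226dc4d449a7135145228e44a28e292472449449a8934d449249249449489b71351269c4d45148a39128a38a491c9125126a24d35124836d80d80d962b62a5204806a08e040480409415b149a5c005259b49b53802522424624112104484a482dd2c490a5004a44848c440481089094905ba588216050c0004945b4db4914924d00592072015816b16ba5db2502d00db4d22916db49149a581056c362485c41312d), ?_⟩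
  rw [card_domainOf_scheme]
  decide +kernel

theorem card_fishburnDomain_9 : (fishburnDomain 9).card = 488 := by
  rw [card_fishburnDomain]
  decide +kernel

theorem card_fishburnDomain_10 : (fishburnDomain 10).card = 1069 := by
  rw [card_fishburnDomain]
  decide +kernel

theorem card_fishburnDomain_11 : (fishburnDomain 11).card = 2324 := by
  rw [card_fishburnDomain]
  decide +kernel

theorem card_fishburnDomain_12 : (fishburnDomain 12).card = 5034 := by
  rw [card_fishburnDomain]
  decide +kernel

theorem card_fishburnDomain_13 : (fishburnDomain 13).card = 10840 := by
  rw [card_fishburnDomain]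
  decide +kernel

theorem card_fishburnDomain_14 : (fishburnDomain 14).card = 23266 := by
  rw [card_fishburnDomain]
  decide +kernel

theorem card_fishburnDomain_15 : (fishburnDomain 15).card = 49704 := by
  rw [card_fishburnDomain]
  decide +kernel

theorem card_fishburnDomain_16 : (fishburnDomain 16).card = 105884 := by
  rw [card_fishburnDomain]
  decide +kernel

theorem card_fishburnDomain_17 : (fishburnDomain 17).card = 224720 := by
  rw [card_fishburnDomain]
  decide +kernel

theorem card_fishburnDomain_18 : (fishburnDomain 18).card = 475773 := by
  rw [card_fishburnDomain]
  decide +kernel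

theorem card_fishburnDomain_19 : (fishburnDomain 19).card = 1004212 := by
  rw [card_fishburnDomain]
  decide +kernel

theorem card_fishburnDomain_20 : (fishburnDomain 20).card = 2115186 := by
  rw [card_fishburnDomain]
  decide +kernel

theorem card_fishburnDomain_21 : (fishburnDomain 21).card = 4443896 := by
  rw [card_fishburnDomain]
  decide +kernel

theorem card_fishburnDomain_22 : (fishburnDomain 22).card = 9319702 := by
  rw [card_fishburnDomain]
  decide +kernel

theorem card_fishburnDomain_23 : (fishburnDomain 23).card = 19503224 := by
  rw [card_fishburnDomain]
  decide +kernel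

theorem card_fishburnDomain_24 : (fishburnDomain 24).card = 40750884 := by
  rw [card_fishburnDomain]
  decide +kernel

theorem card_fishburnDomain_25 : (fishburnDomain 25).card = 84990640 := by
  rw [card_fishburnDomain]
  decide +kernel

/-! ### Consequences for the maximum sizes -/

theorem record_of_peakPit {n s v F : ℕ}
    (hD : ∃ D : Finset (PrefOrder n), IsPeakPitDomain D ∧ D.card = v)
    (hF : (fishburnDomain n).card = F) (hs : s ≤ v) (hFs : F < s) :
    s ≤ maxPeakPitSize n ∧ s ≤ maxCondorcetSize n ∧ (fishburnDomain n).card < s := by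
  obtain ⟨D, hD, rfl⟩ := hD
  exact ⟨hs.trans (card_le_maxPeakPitSize hD), hs.trans (card_le_maxCondorcetSize hD.1), hF ▸ hFs⟩

/-- The Condorcet property passes to subsets, so every smaller size is attained. Being defined by a
complete set of never conditions need not pass to subsets, so the conclusion is only Condorcet. -/
theorem exists_condorcetDomain_of_peakPit {n s v : ℕ}
    (hD : ∃ D : Finset (PrefOrder n), IsPeakPitDomain D ∧ D.card = v) (hs : s ≤ v) :
    ∃ D : Finset (PrefOrder n), IsCondorcetDomain D ∧ D.card = s := by
  obtain ⟨D, hD, rfl⟩ := hD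
  obtain ⟨E, hE, hcard⟩ := Finset.exists_subset_card_eq hs
  exact ⟨E, isCondorcetDomain_mono hE hD.1, hcard⟩

theorem lt_max_of_peakPit {n r v : ℕ}
    (hD : ∃ D : Finset (PrefOrder n), IsPeakPitDomain D ∧ D.card = v) (hr : r < v) :
    r < maxPeakPitSize n ∧ r < maxCondorcetSize n := by
  obtain ⟨D, hD, rfl⟩ := hD
  exact ⟨hr.trans_le (card_le_maxPeakPitSize hD), hr.trans_le (card_le_maxCondorcetSize hD.1)⟩

end PeakPit

open PeakPit

theorem mainTheorem4 :
    -- peak-pit Condorcet domains, as pairs `(n, s)` with `n` alternatives and size `s`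
    (∀ p ∈ ([(9, 492), (10, 1104), (11, 2452), (12, 5520), (13, 12182), (14, 27026),
        (15, 59430), (16, 131536), (17, 292015), (18, 649079), (19, 1432836),
        (20, 3155366)] : List (ℕ × ℕ)),
      (∃ D : Finset (PrefOrder p.1), IsPeakPitDomain D ∧ D.card = p.2) ∧
      p.2 ≤ maxPeakPitSize p.1 ∧ p.2 ≤ maxCondorcetSize p.1 ∧
      (fishburnDomain p.1).card < p.2) ∧
    -- Condorcet domains for larger `n`, again as pairs `(n, s)`
    (∀ p ∈ ([(21, 6674931), (22, 15037178), (23, 33162136), (24, 73279872),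
        (25, 160316046)] : List (ℕ × ℕ)),
      (∃ D : Finset (PrefOrder p.1), IsCondorcetDomain D ∧ D.card = p.2) ∧
      p.2 ≤ maxPeakPitSize p.1 ∧ p.2 ≤ maxCondorcetSize p.1 ∧
      (fishburnDomain p.1).card < p.2) ∧
    -- strict improvement on the previously best lower bounds, as pairs `(n, previous bound)`
    (∀ q ∈ ([(9, 488), (10, 1082), (11, 2349), (12, 5034), (13, 10940), (14, 24481),
        (15, 54752), (16, 123004), (17, 271758), (18, 602299), (19, 1323862),
        (20, 2917604)] : List (ℕ × ℕ)),
      q.2 < maxPeakPitSize q.1 ∧ q.2 < maxCondorcetSize q.1) := by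
  simp only [List.forall_mem_cons]
  refine ⟨⟨⟨exists_peakPitDomain_9, record_of_peakPit exists_peakPitDomain_9 card_fishburnDomain_9 le_rfl
      (by decide)⟩,
    ⟨exists_peakPitDomain_10, record_of_peakPit exists_peakPitDomain_10 card_fishburnDomain_10 le_rfl
      (by decide)⟩,
    ⟨exists_peakPitDomain_11, record_of_peakPit exists_peakPitDomain_11 card_fishburnDomain_11 le_rfl
      (by decide)⟩,
    ⟨exists_peakPitDomain_12, record_of_peakPit exists_peakPitDomain_12 card_fishburnDomain_12 le_rfl
      (by decide)⟩,
    ⟨exists_peakPitDomain_13, record_of_peakPit exists_peakPitDomain_13 card_fishburnDomain_13 le_rfl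
      (by decide)⟩,
    ⟨exists_peakPitDomain_14, record_of_peakPit exists_peakPitDomain_14 card_fishburnDomain_14 le_rfl
      (by decide)⟩,
    ⟨exists_peakPitDomain_15, record_of_peakPit exists_peakPitDomain_15 card_fishburnDomain_15 le_rfl
      (by decide)⟩,
    ⟨exists_peakPitDomain_16, record_of_peakPit exists_peakPitDomain_16 card_fishburnDomain_16 le_rfl
      (by decide)⟩,
    ⟨exists_peakPitDomain_17, record_of_peakPit exists_peakPitDomain_17 card_fishburnDomain_17 le_rfl
      (by decide)⟩,
    ⟨exists_peakPitDomain_18, record_of_peakPit exists_peakPitDomain_18 card_fishburnDomain_18 le_rfl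
      (by decide)⟩,
    ⟨exists_peakPitDomain_19, record_of_peakPit exists_peakPitDomain_19 card_fishburnDomain_19 le_rfl
      (by decide)⟩,
    ⟨exists_peakPitDomain_20, record_of_peakPit exists_peakPitDomain_20 card_fishburnDomain_20 le_rfl
      (by decide)⟩,
    List.forall_mem_nil _⟩, ⟨⟨exists_condorcetDomain_of_peakPit exists_peakPitDomain_21 (by decide),
      record_of_peakPit exists_peakPitDomain_21 card_fishburnDomain_21 (by decide) (by decide)⟩,
    ⟨exists_condorcetDomain_of_peakPit exists_peakPitDomain_22 (by decide),
      record_of_peakPit exists_peakPitDomain_22 card_fishburnDomain_22 (by decide) (by decide)⟩,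
    ⟨exists_condorcetDomain_of_peakPit exists_peakPitDomain_23 (by decide),
      record_of_peakPit exists_peakPitDomain_23 card_fishburnDomain_23 (by decide) (by decide)⟩,
    ⟨exists_condorcetDomain_of_peakPit exists_peakPitDomain_24 (by decide),
      record_of_peakPit exists_peakPitDomain_24 card_fishburnDomain_24 (by decide) (by decide)⟩,
    ⟨exists_condorcetDomain_of_peakPit exists_peakPitDomain_25 (by decide),
      record_of_peakPit exists_peakPitDomain_25 card_fishburnDomain_25 (by decide) (by decide)⟩,
    List.forall_mem_nil _⟩, ⟨lt_max_of_peakPit exists_peakPitDomain_9 (by decide),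
    lt_max_of_peakPit exists_peakPitDomain_10 (by decide),
    lt_max_of_peakPit exists_peakPitDomain_11 (by decide),
    lt_max_of_peakPit exists_peakPitDomain_12 (by decide),
    lt_max_of_peakPit exists_peakPitDomain_13 (by decide),
    lt_max_of_peakPit exists_peakPitDomain_14 (by decide),
    lt_max_of_peakPit exists_peakPitDomain_15 (by decide),
    lt_max_of_peakPit exists_peakPitDomain_16 (by decide),
    lt_max_of_peakPit exists_peakPitDomain_17 (by decide),
    lt_max_of_peakPit exists_peakPitDomain_18 (by decide),
    lt_max_of_peakPit exists_peakPitDomain_19 (by decide),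
    lt_max_of_peakPit exists_peakPitDomain_20 (by decide),
    List.forall_mem_nil _⟩⟩
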